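/- Let $0<2\alpha<1$ and consider the equation $$E(u)\equiv u_{xx}+u_{yy}+u_{zz}+\frac{2\alpha}{x}\,u_x=0 \qquad (1)$$ in the half-space $x>0$ of $\mathbb R^3$. Let $D\subset\{x>0\}$ be a bounded domain (non-empty, open, connected), bounded by a planar open set $X$ of the plane $x=0$ and by a surface (an arbitrary set) $\Gamma\subset\{x>0\}$, in the sense that $\partial D=(\{0\}\times X)\cup\overline\Gamma$ and $\overline\Gamma\cap\{x=0\}=\{0\}\times\gamma$, where $\gamma=\partial X$ is the boundary of $X$ in the plane. No smoothness of $\Gamma$ is required. A regular solution of (1) in $D$ is a function $u\in C^2(D)$ with $E(u)=0$ at every point of $D$. Let $\varphi$ be a continuous function on $\overline\Gamma$. (a) (Dirichlet problem) Let $\tau_1$ be continuous on $\overline X$ with $\varphi(0,y,z)=\tau_1(y,z)$ for $(y,z)\in\gamma$. There is at most one function $u$ on $\overline D$, continuous on $\overline D$ and a regular solution of (1) in $D$, such that $u=\varphi$ on $\overline\Gamma$ and $u(0,y,z)=\tau_1(y,z)$ for $(y,z)\in\overline X$. (b) (Holmgren problem) Let $\nu_1$ be continuous on $X$. There is at most one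 function $u$ on $\overline D$, continuous on $\overline D$ and a regular solution of (1) in $D$, such that $u=\varphi$ on $\overline\Gamma$ and $\lim_{x\to0+}x^{2\alpha}u_x(x,y,z)=\nu_1(y,z)$ for every $(y,z)\in X$. Thus, if the Dirichlet (respectively Holmgren) problem has a regular solution, that solution is unique on $\overline D$. -/

import Mathlib

open Set Filter Topology

noncomputable section

/-- The space `ℝ³` with coordinates `(x, y, z) = (p 0, p 1, p 2)`. -/
abbrev Space3 : Type := EuclideanSpace ℝ (Fin 3)

/-- The coordinate plane `yOz` with coordinates `(y, z) = (q 0, q 1)`. -/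
abbrev PlaneYZ : Type := EuclideanSpace ℝ (Fin 2)

/-- The point `(x, y, z)` lying over the point `q = (y, z)` of the plane. -/
def pointOver (x : ℝ) (q : PlaneYZ) : Space3 := !₂[x, q 0, q 1]

/-- The inclusion `(y, z) ↦ (0, y, z)` of the plane `yOz` into space. -/
def onPlane (q : PlaneYZ) : Space3 := pointOver 0 q

/-- The partial derivative of `u` with respect to the `i`-th coordinate at `p`. -/
def partialD (i : Fin 3) (u : Space3 → ℝ) (p : Space3) : ℝ :=
  lineDeriv ℝ u p (EuclideanSpace.single i 1)

/-- The operator `E(u) = u_xx + u_yy + u_zz + (2α / x) u_x`. -/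
def operatorE (α : ℝ) (u : Space3 → ℝ) (p : Space3) : ℝ :=
  partialD 0 (partialD 0 u) p + partialD 1 (partialD 1 u) p + partialD 2 (partialD 2 u) p
    + 2 * α / p 0 * partialD 0 u p

/-- `D` is a bounded domain of the half-space `x > 0` bounded by the open piece `X` of the plane
`x = 0` and by the surface `Γ`, which lies in `x > 0`; the common boundary `γ` of `X` and `Γ`
is the part of the closure of `Γ` that lies in the plane. -/
structure IsBoundedBy (D : Set Space3) (X : Set PlaneYZ) (Γ : Set Space3) : Prop where
  isOpen : IsOpen D
  isConnected : IsConnected D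
  isBounded : Bornology.IsBounded D
  pos : ∀ p ∈ D, 0 < p 0
  isOpen_base : IsOpen X
  pos_surface : ∀ p ∈ Γ, 0 < p 0
  frontier_eq : frontier D = onPlane '' X ∪ closure Γ
  common_boundary : closure Γ ∩ {p | p 0 = 0} = onPlane '' frontier X

/-- A regular solution of `E(u) = 0` in `D`: twice continuously differentiable in the open set `D`
and satisfying the equation at every point of `D`. -/
def IsRegularSolution (α : ℝ) (D : Set Space3) (u : Space3 → ℝ) : Prop :=
  ContDiffOn ℝ 2 u D ∧ ∀ p ∈ D, operatorE α u p = 0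

/-- `u` solves the Dirichlet problem in `D` with data `φ` on `Γ` (including its edge)
and `τ` on the closure of `X`. -/
structure IsDirichletSolution (α : ℝ) (D : Set Space3) (X : Set PlaneYZ) (Γ : Set Space3)
    (φ : Space3 → ℝ) (τ : PlaneYZ → ℝ) (u : Space3 → ℝ) : Prop where
  regular : IsRegularSolution α D u
  continuousOn : ContinuousOn u (closure D)
  eq_surface : ∀ p ∈ closure Γ, u p = φ p
  eq_base : ∀ q ∈ closure X, u (onPlane q) = τ q

/-- `u` solves the Holmgren problem in `D` with data `φ` on `Γ` (including its edge) and
`lim_{x → 0+} x^{2α} u_x(x, y, z) = ν(y, z)` for each `(y, z)` in `X`. -/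
structure IsHolmgrenSolution (α : ℝ) (D : Set Space3) (X : Set PlaneYZ) (Γ : Set Space3)
    (φ : Space3 → ℝ) (ν : PlaneYZ → ℝ) (u : Space3 → ℝ) : Prop where
  regular : IsRegularSolution α D u
  continuousOn : ContinuousOn u (closure D)
  eq_surface : ∀ p ∈ closure Γ, u p = φ p
  tendsto_base : ∀ q ∈ X,
    Tendsto (fun x : ℝ => x ^ (2 * α) * partialD 0 u (pointOver x q)) (𝓝[>] 0) (𝓝 (ν q))

end

/-!
The difference `w` of two solutions is a regular solution that vanishes on the closure of `Γ`, and
on the base `X` either vanishes or satisfies `x^{2α} w_x → 0`. It suffices to show `w ≤ 0`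
(`IsRegularSolution.nonpos`), since the roles of the two solutions may be exchanged.

For `ε > 0` put `W = w + ε b` with the barrier `b = y² + x^{1 - 2α}`, which is continuous and
nonnegative on the closure of `D`. Since `E(b) = 2` (`operatorE_barrier`), `E(W) > 0` in `D`, so the
second derivative test along coordinate lines (`IsLocalMax.operatorE_nonpos`) excludes an interior
maximum of `W`. If `x^{2α} w_x → 0` at a point of `X`, then `x^{2α} W_x` tends to
`ε (1 - 2α) > 0`, so `W` increases strictly as one enters `D` from that point and has no maximum
there (`IsBoundedBy.not_isMaxOn_base`); the segment entering `D` exists by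
`IsBoundedBy.exists_segment`. Hence `W` attains its maximum where `w ≤ 0`, which gives
`w ≤ ε sup b`, and `ε → 0` finishes the proof.
-/

open Set Filter Topology

/-! ### The operator on twice differentiable functions -/

lemma pointOver_zero_coord (x : ℝ) (q : PlaneYZ) : pointOver x q 0 = x := by
  simp [pointOver]

lemma pointOver_add (x t : ℝ) (q : PlaneYZ) :
    pointOver x q + t • EuclideanSpace.single 0 1 = pointOver (x + t) q := by
  ext i
  fin_cases i <;> simp [pointOver]

lemma dist_pointOver (x t : ℝ) (q : PlaneYZ) : dist (pointOver x q) (pointOver t q) = |x - t| := by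
  simp [pointOver, EuclideanSpace.dist_eq, Fin.sum_univ_three, Real.dist_eq, Real.sqrt_sq_eq_abs]

lemma continuous_pointOver (q : PlaneYZ) : Continuous fun x : ℝ => pointOver x q :=
  (Isometry.of_dist_eq fun x t => by rw [dist_pointOver, Real.dist_eq]).continuous

lemma hasDerivAt_pointOver_comp {u : Space3 → ℝ} {x : ℝ} {q : PlaneYZ}
    (hu : DifferentiableAt ℝ u (pointOver x q)) :
    HasDerivAt (fun t => u (pointOver t q)) (partialD 0 u (pointOver x q)) x := by
  have h := (hu.lineDifferentiableAt (v := EuclideanSpace.single 0 1)).hasLineDerivAt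
  unfold HasLineDerivAt at h
  simp only [pointOver_add] at h
  have h0 : HasDerivAt (fun t => u (pointOver (x + t) q)) (partialD 0 u (pointOver x q)) (x - x) := by
    simpa [partialD] using h
  simpa using h0.comp_sub_const x x

lemma partialD_eq_fderiv {u : Space3 → ℝ} {p : Space3} (i : Fin 3) (hu : DifferentiableAt ℝ u p) :
    partialD i u p = fderiv ℝ u p (EuclideanSpace.single i 1) :=
  hu.lineDeriv_eq_fderiv

lemma partialD_congr {u v : Space3 → ℝ} {p : Space3} (i : Fin 3) (h : u =ᶠ[𝓝 p] v) :
    partialD i u p = partialD i v p :=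
  h.lineDeriv_eq

lemma partialD_add {u v : Space3 → ℝ} {p : Space3} (i : Fin 3)
    (hu : DifferentiableAt ℝ u p) (hv : DifferentiableAt ℝ v p) :
    partialD i (u + v) p = partialD i u p + partialD i v p := by
  rw [partialD_eq_fderiv i hu, partialD_eq_fderiv i hv, partialD_eq_fderiv i (hu.add hv),
    fderiv_add hu hv, add_apply]

lemma partialD_const_smul {u : Space3 → ℝ} {p : Space3} (i : Fin 3) (c : ℝ)
    (hu : DifferentiableAt ℝ u p) : partialD i (c • u) p = c * partialD i u p := by
  rw [partialD_eq_fderiv i hu, partialD_eq_fderiv i (hu.const_smul c), fderiv_const_smul hu]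
  simp

lemma ContDiffOn.differentiableAt_of_isOpen {D : Set Space3} (hD : IsOpen D) {u : Space3 → ℝ}
    (hu : ContDiffOn ℝ 2 u D) {p : Space3} (hp : p ∈ D) : DifferentiableAt ℝ u p :=
  (hu.differentiableOn (by norm_num)).differentiableAt (hD.mem_nhds hp)

lemma ContDiffOn.differentiableAt_partialD {D : Set Space3} (hD : IsOpen D) {u : Space3 → ℝ}
    (hu : ContDiffOn ℝ 2 u D) (i : Fin 3) {p : Space3} (hp : p ∈ D) :
    DifferentiableAt ℝ (partialD i u) p := by
  have h1 : ContDiffOn ℝ 1 (fderiv ℝ u) D := hu.fderiv_of_isOpen hD (by norm_num)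
  have h2 : DifferentiableAt ℝ (fun x => fderiv ℝ u x (EuclideanSpace.single i 1)) p :=
    ((h1.differentiableOn (by norm_num)).differentiableAt (hD.mem_nhds hp)).clm_apply
      (differentiableAt_const _)
  refine h2.congr_of_eventuallyEq ?_
  filter_upwards [hD.mem_nhds hp] with x hx
  exact partialD_eq_fderiv i (hu.differentiableAt_of_isOpen hD hx)

lemma operatorE_add {D : Set Space3} (hD : IsOpen D) {u v : Space3 → ℝ} (α : ℝ)
    (hu : ContDiffOn ℝ 2 u D) (hv : ContDiffOn ℝ 2 v D) {p : Space3} (hp : p ∈ D) :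
    operatorE α (u + v) p = operatorE α u p + operatorE α v p := by
  have du : ∀ x ∈ D, DifferentiableAt ℝ u x := fun _ hx => hu.differentiableAt_of_isOpen hD hx
  have dv : ∀ x ∈ D, DifferentiableAt ℝ v x := fun _ hx => hv.differentiableAt_of_isOpen hD hx
  have key (i : Fin 3) : partialD i (partialD i (u + v)) p
      = partialD i (partialD i u) p + partialD i (partialD i v) p := by
    rw [← partialD_add i (hu.differentiableAt_partialD hD i hp)
      (hv.differentiableAt_partialD hD i hp)]
    refine partialD_congr i ?_
    filter_upwards [hD.mem_nhds hp] with x hx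
    exact partialD_add i (du x hx) (dv x hx)
  simp only [operatorE, key, partialD_add 0 (du p hp) (dv p hp)]
  ring

lemma operatorE_const_smul {D : Set Space3} (hD : IsOpen D) {u : Space3 → ℝ} (α c : ℝ)
    (hu : ContDiffOn ℝ 2 u D) {p : Space3} (hp : p ∈ D) :
    operatorE α (c • u) p = c * operatorE α u p := by
  have du : ∀ x ∈ D, DifferentiableAt ℝ u x := fun _ hx => hu.differentiableAt_of_isOpen hD hx
  have key (i : Fin 3) : partialD i (partialD i (c • u)) p = c * partialD i (partialD i u) p := by
    rw [← partialD_const_smul i c (hu.differentiableAt_partialD hD i hp)]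
    refine partialD_congr i ?_
    filter_upwards [hD.mem_nhds hp] with x hx
    exact partialD_const_smul i c (du x hx)
  simp only [operatorE, key, partialD_const_smul 0 c (du p hp)]
  ring

lemma sub_eq_add_neg_one_smul (u v : Space3 → ℝ) : u - v = u + (-1 : ℝ) • v := by
  rw [neg_one_smul, sub_eq_add_neg]

lemma IsRegularSolution.sub {α : ℝ} {D : Set Space3} (hD : IsOpen D) {u v : Space3 → ℝ}
    (hu : IsRegularSolution α D u) (hv : IsRegularSolution α D v) :
    IsRegularSolution α D (u - v) := by
  refine ⟨hu.1.sub hv.1, fun p hp => ?_⟩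
  have hv' : ContDiffOn ℝ 2 ((-1 : ℝ) • v) D := hv.1.const_smul (-1 : ℝ)
  rw [sub_eq_add_neg_one_smul, operatorE_add hD α hu.1 hv' hp,
    operatorE_const_smul hD α (-1) hv.1 hp, hu.2 p hp, hv.2 p hp]
  simp

/-! ### Interior maxima -/

/-- The second derivative test, in the form of a necessary condition. Differentiability is not
assumed: a function without a second derivative has `deriv (deriv g) a = 0`. -/
lemma IsLocalMax.deriv_deriv_nonpos {g : ℝ → ℝ} {a : ℝ} (h : IsLocalMax g a)
    (hc : ContinuousAt g a) : deriv (deriv g) a ≤ 0 := by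
  by_contra! hpos
  have hmin : IsLocalMin g a := isLocalMin_of_deriv_deriv_pos hpos h.deriv_eq_zero hc
  -- A local minimum that is also a local maximum makes `g` locally constant.
  have heq : g =ᶠ[𝓝 a] fun _ => g a := by
    filter_upwards [h, hmin] with x h1 h2 using le_antisymm h1 h2
  have : deriv (deriv g) a = 0 := by
    rw [heq.deriv.deriv_eq]
    simp
  exact hpos.ne' this

lemma partialD_line (i : Fin 3) (u : Space3 → ℝ) (p : Space3) (t : ℝ) :
    partialD i u (p + t • EuclideanSpace.single i 1)
      = deriv (fun s : ℝ => u (p + s • EuclideanSpace.single i 1)) t := by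
  have h := deriv_comp_const_add (fun s : ℝ => u (p + s • EuclideanSpace.single i 1)) t 0
  rw [add_zero] at h
  rw [← h]
  simp only [partialD, lineDeriv, add_smul, add_assoc]

/-- At a local maximum the first derivatives vanish and the pure second derivatives are
nonpositive, so the singular coefficient plays no role. -/
lemma IsLocalMax.operatorE_nonpos {u : Space3 → ℝ} {p : Space3} (α : ℝ) (h : IsLocalMax u p)
    (hc : ContinuousAt u p) : operatorE α u p ≤ 0 := by
  have hline (i : Fin 3) : ContinuousAt (fun t : ℝ => p + t • EuclideanSpace.single i (1 : ℝ)) 0 :=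
    by fun_prop
  have hmax (i : Fin 3) :
      IsLocalMax (fun t : ℝ => u (p + t • EuclideanSpace.single i (1 : ℝ))) 0 := by
    have h' : IsLocalMax u (p + (0 : ℝ) • EuclideanSpace.single i (1 : ℝ)) := by simpa using h
    exact IsLocalMax.comp_continuous
      (g := fun t : ℝ => p + t • EuclideanSpace.single i (1 : ℝ)) h' (hline i)
  have hfirst : partialD 0 u p = 0 := (hmax 0).deriv_eq_zero
  have hsecond (i : Fin 3) : partialD i (partialD i u) p ≤ 0 := by
    have h1 : partialD i (partialD i u) p
        = deriv (deriv fun t : ℝ => u (p + t • EuclideanSpace.single i (1 : ℝ))) 0 := by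
      rw [partialD, lineDeriv]
      simp only [partialD_line]
    rw [h1]
    refine (hmax i).deriv_deriv_nonpos (ContinuousAt.comp' ?_ (hline i))
    simpa using hc
  rw [operatorE, hfirst, mul_zero, add_zero]
  linarith [hsecond 0, hsecond 1, hsecond 2]

/-! ### The barrier -/

/-- The barrier `y² + x^{1 - 2α}`. The first term makes `E` positive; the second is a solution of
the equation whose conormal derivative `x^{2α} ∂/∂x` on the plane `x = 0` is `1 - 2α`. -/
noncomputable def barrier (α : ℝ) (p : Space3) : ℝ := p 1 ^ 2 + p 0 ^ (1 - 2 * α)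

lemma continuous_barrier {α : ℝ} (hα : 2 * α < 1) : Continuous (barrier α) := by
  unfold barrier
  have h0 : Continuous fun p : Space3 => p 0 := by fun_prop
  have h1 : Continuous fun p : Space3 => p 1 := by fun_prop
  exact (h1.pow 2).add (h0.rpow_const fun _ => Or.inr (by linarith))

lemma barrier_nonneg (α : ℝ) {p : Space3} (hp : 0 ≤ p 0) : 0 ≤ barrier α p :=
  add_nonneg (sq_nonneg _) (Real.rpow_nonneg hp _)

lemma contDiffOn_barrier (α : ℝ) {D : Set Space3} (hD : ∀ p ∈ D, 0 < p 0) :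
    ContDiffOn ℝ 2 (barrier α) D := by
  have h0 : ContDiff ℝ 2 fun p : Space3 => p 0 := by fun_prop
  have h1 : ContDiff ℝ 2 fun p : Space3 => p 1 := by fun_prop
  exact (h1.pow 2).contDiffOn.add (h0.contDiffOn.rpow_const_of_ne fun p hp => (hD p hp).ne')

lemma partialD_zero_barrier (α : ℝ) {p : Space3} (hp : 0 < p 0) :
    partialD 0 (barrier α) p = (1 - 2 * α) * p 0 ^ (-(2 * α)) := by
  have h : HasDerivAt (fun t : ℝ => p 1 ^ 2 + (p 0 + t) ^ (1 - 2 * α))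
      ((1 - 2 * α) * p 0 ^ (-(2 * α))) 0 := by
    have h1 : HasDerivAt (fun t : ℝ => p 0 + t) 1 0 := (hasDerivAt_id _).const_add _
    have h2 := (h1.rpow_const (p := 1 - 2 * α) (Or.inl (by simpa using hp.ne'))).const_add (p 1 ^ 2)
    rwa [one_mul, add_zero, show (1 : ℝ) - 2 * α - 1 = -(2 * α) by ring] at h2
  rw [← h.deriv]
  simp [partialD, lineDeriv, barrier]

lemma operatorE_barrier (α : ℝ) {p : Space3} (hp : 0 < p 0) : operatorE α (barrier α) p = 2 := by
  have h0 : partialD 0 (partialD 0 (barrier α)) p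
      = (1 - 2 * α) * (-(2 * α) * p 0 ^ (-(2 * α) - 1)) := by
    have hopen : {x : Space3 | 0 < x 0} ∈ 𝓝 p :=
      (isOpen_lt continuous_const (by fun_prop)).mem_nhds hp
    rw [partialD_congr 0 (v := fun x => (1 - 2 * α) * x 0 ^ (-(2 * α)))
      (by filter_upwards [hopen] with x hx using partialD_zero_barrier α hx)]
    have h1 : HasDerivAt (fun t : ℝ => p 0 + t) 1 0 := (hasDerivAt_id _).const_add _
    have h2 := (h1.rpow_const (p := -(2 * α)) (Or.inl (by simpa using hp.ne'))).const_mul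
      (1 - 2 * α)
    have h3 : (1 - 2 * α) * (-(2 * α) * p 0 ^ (-(2 * α) - 1))
        = (1 - 2 * α) * (1 * (-(2 * α)) * (p 0 + 0) ^ (-(2 * α) - 1)) := by simp
    rw [h3, ← h2.deriv]
    simp [partialD, lineDeriv]
  have h1 : partialD 1 (partialD 1 (barrier α)) p = 2 := by
    have hd : partialD 1 (barrier α) = fun x : Space3 => 2 * x 1 := by
      funext x
      have h : HasDerivAt (fun t : ℝ => (x 1 + t) ^ 2 + x 0 ^ (1 - 2 * α)) (2 * x 1) 0 := by
        have h1 : HasDerivAt (fun t : ℝ => x 1 + t) 1 0 := (hasDerivAt_id _).const_add _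
        simpa using (h1.pow 2).add_const (x 0 ^ (1 - 2 * α))
      rw [← h.deriv]
      simp [partialD, lineDeriv, barrier]
    have h : HasDerivAt (fun t : ℝ => 2 * (p 1 + t)) 2 0 := by
      simpa using ((hasDerivAt_id (0 : ℝ)).const_add (p 1)).const_mul 2
    rw [hd, ← h.deriv]
    simp [partialD, lineDeriv]
  have h2 : partialD 2 (partialD 2 (barrier α)) p = 0 := by
    have hd : partialD 2 (barrier α) = fun _ => 0 := by
      funext x
      simp [partialD, lineDeriv, barrier]
    rw [hd]
    simp [partialD, lineDeriv]
  rw [operatorE, h0, h1, h2, partialD_zero_barrier α hp, Real.rpow_sub_one hp.ne']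
  field_simp
  ring

/-! ### The domain near its planar base -/

/-- The base is off the closure of the surface, so that near a point of it the frontier of `D` lies
in the plane `x = 0`; a small half-ball is connected, meets `D` and misses its frontier. -/
lemma IsBoundedBy.exists_segment {D : Set Space3} {X : Set PlaneYZ} {Γ : Set Space3}
    (hD : IsBoundedBy D X Γ) {q : PlaneYZ} (hq : q ∈ X) :
    ∃ r > 0, ∀ x ∈ Ioo 0 r, pointOver x q ∈ D := by
  have hnot : onPlane q ∉ closure Γ := by
    intro hmem
    have : onPlane q ∈ onPlane '' frontier X := by
      rw [← hD.common_boundary]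
      exact ⟨hmem, pointOver_zero_coord 0 q⟩
    obtain ⟨q', hq', heq⟩ := this
    have hqq : q' = q := by
      have h1 := congrArg (fun p : Space3 => p 1) heq
      have h2 := congrArg (fun p : Space3 => p 2) heq
      ext i
      fin_cases i
      · simpa [onPlane, pointOver] using h1
      · simpa [onPlane, pointOver] using h2
    subst hqq
    rw [hD.isOpen_base.frontier_eq] at hq'
    exact hq'.2 hq
  obtain ⟨r, hr, hball⟩ := Metric.isOpen_iff.1 isClosed_closure.isOpen_compl _ hnot
  have hconv : Convex ℝ (Metric.ball (onPlane q) r ∩ {p : Space3 | 0 < p 0}) :=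
    (convex_ball _ _).inter (convex_halfSpace_gt (𝕜 := ℝ) (f := fun p : Space3 => p 0)
      ⟨fun _ _ => rfl, fun _ _ => rfl⟩ 0)
  have hmeet : ((Metric.ball (onPlane q) r ∩ {p : Space3 | 0 < p 0}) ∩ D).Nonempty := by
    have hcl : onPlane q ∈ closure D :=
      frontier_subset_closure (hD.frontier_eq ▸ Or.inl (mem_image_of_mem _ hq))
    obtain ⟨p, hpD, hp⟩ := Metric.mem_closure_iff.1 hcl r hr
    exact ⟨p, ⟨Metric.mem_ball'.2 hp, hD.pos p hpD⟩, hpD⟩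
  have hsub : Metric.ball (onPlane q) r ∩ {p : Space3 | 0 < p 0} ⊆ D := by
    refine hconv.isPreconnected.subset_left_of_subset_union hD.isOpen
      isClosed_closure.isOpen_compl (disjoint_compl_right_iff_subset.2 subset_closure)
      (fun b hb => ?_) hmeet
    by_contra hbD
    rw [mem_union, not_or, notMem_compl_iff] at hbD
    have hbf : b ∈ frontier D := by
      rw [hD.isOpen.frontier_eq]
      exact ⟨hbD.2, hbD.1⟩
    rw [hD.frontier_eq] at hbf
    rcases hbf with ⟨q', -, rfl⟩ | hbf
    · exact hb.2.ne' (pointOver_zero_coord 0 q')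
    · exact hball hb.1 hbf
  refine ⟨r, hr, fun x hx => hsub ⟨?_, ?_⟩⟩
  · rw [Metric.mem_ball, onPlane, dist_pointOver, sub_zero, abs_of_pos hx.1]
    exact hx.2
  · simpa [pointOver_zero_coord] using hx.1

/-! ### The maximum principle -/

/-- A function that increases in `x` near a point of the base has no maximum there. -/
lemma IsBoundedBy.not_isMaxOn_base {D : Set Space3} {X : Set PlaneYZ} {Γ : Set Space3}
    (hD : IsBoundedBy D X Γ) {W : Space3 → ℝ} (hc : ContinuousOn W (closure D))
    (hd : ∀ p ∈ D, DifferentiableAt ℝ W p) {q : PlaneYZ} (hq : q ∈ X)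
    (hpos : ∀ᶠ x in 𝓝[>] (0 : ℝ), 0 < partialD 0 W (pointOver x q)) :
    ¬ IsMaxOn W (closure D) (onPlane q) := by
  intro hmax
  obtain ⟨r, hr, hseg⟩ := hD.exists_segment hq
  obtain ⟨s, hs, hs'⟩ := mem_nhdsGT_iff_exists_Ioo_subset.1 hpos
  have hm : 0 < min r s := lt_min hr hs
  set m := min r s / 2 with hmdef
  have hm0 : 0 < m := by positivity
  have hmr : m < r := by linarith [min_le_left r s]
  have hms : m < s := by linarith [min_le_right r s]
  have hcl : ∀ x ∈ Icc 0 m, pointOver x q ∈ closure D := by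
    intro x hx
    rcases hx.1.eq_or_lt with rfl | h0
    · exact frontier_subset_closure (hD.frontier_eq ▸ Or.inl (mem_image_of_mem _ hq))
    · exact subset_closure (hseg x ⟨h0, hx.2.trans_lt hmr⟩)
  have hmono : StrictMonoOn (fun x => W (pointOver x q)) (Icc 0 m) := by
    refine strictMonoOn_of_deriv_pos (convex_Icc 0 m)
      (hc.comp (continuous_pointOver q).continuousOn hcl) fun x hx => ?_
    rw [interior_Icc] at hx
    rw [(hasDerivAt_pointOver_comp (hd _ (hseg x ⟨hx.1, hx.2.trans hmr⟩))).deriv]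
    exact hs' ⟨hx.1, hx.2.trans hms⟩
  have h1 : W (pointOver 0 q) < W (pointOver m q) :=
    hmono (left_mem_Icc.2 hm0.le) (right_mem_Icc.2 hm0.le) hm0
  exact (hmax (hcl m (right_mem_Icc.2 hm0.le))).not_gt h1

/-- Maximum principle with a mixed condition on the base: at each of its points either the solution
is nonpositive or its conormal derivative vanishes. -/
lemma IsRegularSolution.nonpos {α : ℝ} (hα : 2 * α < 1) {D : Set Space3} {X : Set PlaneYZ}
    {Γ : Set Space3} (hD : IsBoundedBy D X Γ) {w : Space3 → ℝ} (hw : IsRegularSolution α D w)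
    (hc : ContinuousOn w (closure D)) (hΓ : ∀ p ∈ closure Γ, w p ≤ 0)
    (hX : ∀ q ∈ X, w (onPlane q) ≤ 0 ∨
      Tendsto (fun x : ℝ => x ^ (2 * α) * partialD 0 w (pointOver x q)) (𝓝[>] 0) (𝓝 0)) :
    ∀ p ∈ closure D, w p ≤ 0 := by
  have hcomp : IsCompact (closure D) := hD.isBounded.isCompact_closure
  have hne : (closure D).Nonempty := hD.isConnected.nonempty.closure
  have hx0 : ∀ p ∈ closure D, 0 ≤ p 0 := fun p hp =>
    closure_minimal (fun x hx => (hD.pos x hx).le)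
      (isClosed_le continuous_const (by fun_prop : Continuous fun p : Space3 => p 0)) hp
  have hbc : ContinuousOn (barrier α) (closure D) := (continuous_barrier hα).continuousOn
  obtain ⟨C, hC⟩ : ∃ C, ∀ p ∈ closure D, barrier α p ≤ C := by
    obtain ⟨C, hC⟩ := hcomp.bddAbove_image hbc
    exact ⟨C, fun p hp => hC (mem_image_of_mem _ hp)⟩
  have hb2 := contDiffOn_barrier α hD.pos
  have hdiff {f : Space3 → ℝ} (hf : ContDiffOn ℝ 2 f D) : ∀ p ∈ D, DifferentiableAt ℝ f p :=
    fun _ hp => hf.differentiableAt_of_isOpen hD.isOpen hp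
  have key : ∀ ε > 0, ∀ p ∈ closure D, w p ≤ ε * C := by
    intro ε hε p hp
    set W : Space3 → ℝ := w + ε • barrier α with hW
    have hWc : ContinuousOn W (closure D) := hc.add (hbc.const_smul ε)
    have hεb : ContDiffOn ℝ 2 (ε • barrier α) D := hb2.const_smul ε
    have hW2 : ContDiffOn ℝ 2 W D := hw.1.add hεb
    obtain ⟨m, hm, hmax⟩ := hcomp.exists_isMaxOn hne hWc
    have hwm : w m ≤ 0 := by
      by_cases hmD : m ∈ D
      -- An interior maximum contradicts `E(W) = 2 ε > 0`.
      · have hloc : IsLocalMax W m :=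
          (hmax.on_subset subset_closure).isLocalMax (hD.isOpen.mem_nhds hmD)
        have h1 := hloc.operatorE_nonpos α (hdiff hW2 m hmD).continuousAt
        rw [hW, operatorE_add hD.isOpen α hw.1 hεb hmD, operatorE_const_smul hD.isOpen α ε hb2 hmD,
          hw.2 m hmD, operatorE_barrier α (hD.pos m hmD)] at h1
        linarith
      · have hf : m ∈ frontier D := by
          rw [hD.isOpen.frontier_eq]
          exact ⟨hm, hmD⟩
        rw [hD.frontier_eq] at hf
        rcases hf with ⟨q, hq, rfl⟩ | hf
        · refine (hX q hq).resolve_right fun hlim => ?_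
          obtain ⟨r, hr, hseg⟩ := hD.exists_segment hq
          refine hD.not_isMaxOn_base hWc (hdiff hW2) hq ?_ hmax
          have hneg : -(ε * (1 - 2 * α)) < 0 := by
            have := mul_pos hε (sub_pos.2 hα)
            linarith
          filter_upwards [hlim.eventually (lt_mem_nhds hneg), Ioo_mem_nhdsGT hr] with x h1 hx
          have hxD := hseg x hx
          have hpx : 0 < x ^ (2 * α) := Real.rpow_pos_of_pos hx.1 _
          have hval : x ^ (2 * α) * partialD 0 W (pointOver x q)
              = x ^ (2 * α) * partialD 0 w (pointOver x q) + ε * (1 - 2 * α) := by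
            rw [hW, partialD_add 0 (hdiff hw.1 _ hxD) (hdiff hεb _ hxD),
              partialD_const_smul 0 ε (hdiff hb2 _ hxD),
              partialD_zero_barrier α (hD.pos _ hxD), pointOver_zero_coord, Real.rpow_neg hx.1.le]
            field_simp
          exact pos_of_mul_pos_right (by rw [hval]; linarith) hpx.le
        · exact hΓ m hf
    have h1 : w p + ε * barrier α p ≤ w m + ε * barrier α m := hmax hp
    have h2 := mul_le_mul_of_nonneg_left (hC m hm) hε.le
    have h3 := mul_nonneg hε.le (barrier_nonneg α (hx0 p hp))
    linarith
  intro p hp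
  have hlim : Tendsto (fun ε : ℝ => ε * C) (𝓝[>] 0) (𝓝 0) := by
    have : Tendsto (fun ε : ℝ => ε * C) (𝓝 0) (𝓝 (0 * C)) := tendsto_id.mul_const C
    rw [zero_mul] at this
    exact this.mono_left nhdsWithin_le_nhds
  refine ge_of_tendsto hlim ?_
  filter_upwards [self_mem_nhdsWithin] with ε hε using key ε hε p hp

/-! ### Uniqueness -/

lemma IsDirichletSolution.le {α : ℝ} (hα : 2 * α < 1) {D : Set Space3} {X : Set PlaneYZ}
    {Γ : Set Space3} (hD : IsBoundedBy D X Γ) {φ : Space3 → ℝ} {τ : PlaneYZ → ℝ}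
    {u v : Space3 → ℝ} (hu : IsDirichletSolution α D X Γ φ τ u)
    (hv : IsDirichletSolution α D X Γ φ τ v) : ∀ p ∈ closure D, u p ≤ v p := by
  intro p hp
  have h := (hu.regular.sub hD.isOpen hv.regular).nonpos hα hD
    (hu.continuousOn.sub hv.continuousOn)
    (fun x hx => by simp [hu.eq_surface x hx, hv.eq_surface x hx])
    (fun q hq => Or.inl (by
      simp [hu.eq_base q (subset_closure hq), hv.eq_base q (subset_closure hq)])) p hp
  exact sub_nonpos.1 h

lemma IsHolmgrenSolution.le {α : ℝ} (hα : 2 * α < 1) {D : Set Space3} {X : Set PlaneYZ}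
    {Γ : Set Space3} (hD : IsBoundedBy D X Γ) {φ : Space3 → ℝ} {ν : PlaneYZ → ℝ}
    {u v : Space3 → ℝ} (hu : IsHolmgrenSolution α D X Γ φ ν u)
    (hv : IsHolmgrenSolution α D X Γ φ ν v) : ∀ p ∈ closure D, u p ≤ v p := by
  have hdiff {f : Space3 → ℝ} (hf : ContDiffOn ℝ 2 f D) : ∀ p ∈ D, DifferentiableAt ℝ f p :=
    fun _ hp => hf.differentiableAt_of_isOpen hD.isOpen hp
  intro p hp
  refine sub_nonpos.1 ((hu.regular.sub hD.isOpen hv.regular).nonpos hα hD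
    (hu.continuousOn.sub hv.continuousOn)
    (fun x hx => by simp [hu.eq_surface x hx, hv.eq_surface x hx]) (fun q hq => Or.inr ?_) p hp)
  obtain ⟨r, hr, hseg⟩ := hD.exists_segment hq
  have hlim := (hu.tendsto_base q hq).sub (hv.tendsto_base q hq)
  rw [sub_self] at hlim
  refine hlim.congr' ?_
  filter_upwards [Ioo_mem_nhdsGT hr] with x hx
  have hxD := hseg x hx
  rw [sub_eq_add_neg_one_smul, partialD_add 0 (hdiff hu.regular.1 _ hxD)
    ((hdiff hv.regular.1 _ hxD).const_smul (-1 : ℝ)),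
    partialD_const_smul 0 (-1) (hdiff hv.regular.1 _ hxD)]
  ring

theorem mainTheorem6 (α : ℝ) (hα0 : 0 < 2 * α) (hα1 : 2 * α < 1)
    (D : Set Space3) (X : Set PlaneYZ) (Γ : Set Space3) (hD : IsBoundedBy D X Γ)
    (φ : Space3 → ℝ) (hφ : ContinuousOn φ (closure Γ)) :
    (∀ τ : PlaneYZ → ℝ, ContinuousOn τ (closure X) →
      (∀ q ∈ frontier X, φ (onPlane q) = τ q) →
      ∀ u v : Space3 → ℝ, IsDirichletSolution α D X Γ φ τ u →
        IsDirichletSolution α D X Γ φ τ v → EqOn u v (closure D)) ∧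
    (∀ ν : PlaneYZ → ℝ, ContinuousOn ν X →
      ∀ u v : Space3 → ℝ, IsHolmgrenSolution α D X Γ φ ν u →
        IsHolmgrenSolution α D X Γ φ ν v → EqOn u v (closure D)) := by
  exact ⟨fun _ _ _ _ _ hu hv p hp => le_antisymm (hu.le hα1 hD hv p hp) (hv.le hα1 hD hu p hp),
    fun _ _ _ _ hu hv p hp => le_antisymm (hu.le hα1 hD hv p hp) (hv.le hα1 hD hu p hp)⟩
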